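/- Let $d$ be a squarefree integer and let $H^d$ be the smooth projective genus one curve over $\mathbb{Q}$ with affine equation $dy^2=(x^2-x-3)(x^2+2x-12)$, that is, the curve $dy^2=(x^2-xz-3z^2)(x^2+2xz-12z^2)$ in the weighted projective plane with weights $(1,2,1)$ for $(x,y,z)$. Then $H^d$ is everywhere locally solvable, i.e. $H^d(\mathbb{R})\neq\emptyset$ and $H^d(\mathbb{Q}_p)\neq\emptyset$ for all primes $p$, if and only if every prime $p$ dividing $d$ satisfies $\left(\frac{p}{13}\right)=1$ or $p=13$. -/

import Mathlib

instance fact_prime_thirteen : Fact (Nat.Prime 13) := ⟨by norm_num⟩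

namespace TwistedQuartic

/-- The binary quartic form `F(x, z)`, the homogenization of `(x² - x - 3)(x² + 2x - 12)`. -/
def form {K : Type*} [Field K] (x z : K) : K :=
  (x ^ 2 - x * z - 3 * z ^ 2) * (x ^ 2 + 2 * x * z - 12 * z ^ 2)

/-- `H^d(K) ≠ ∅`, where `H^d : d y² = (x² - x - 3)(x² + 2x - 12)` is the smooth projective genus
one curve `d y² = F(x, z)` in the weighted projective plane with weights `(1, 2, 1)` for
`(x, y, z)`. The points with `z ≠ 0` are those of the affine equation; the points with `z = 0`
are the two points at infinity, which are defined over `K` iff `d` is a square in `K`. (The case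
`x = z = 0` would force `y = 0`, so excluding it excludes exactly the zero vector, for `d ≠ 0`
in `K`.) -/
def HasPoint (d : ℤ) (K : Type*) [Field K] : Prop :=
  ∃ x y z : K, (x ≠ 0 ∨ z ≠ 0) ∧ (d : K) * y ^ 2 = form x z

/-- For `d ≠ 0` in `K`, a point is a point of the affine equation or one of the two points at
infinity. -/
theorem hasPoint_iff {K : Type*} [Field K] {d : ℤ} (hd : (d : K) ≠ 0) :
    HasPoint d K ↔
      (∃ x y : K, (d : K) * y ^ 2 = (x ^ 2 - x - 3) * (x ^ 2 + 2 * x - 12)) ∨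
        IsSquare (d : K) := by
  constructor
  · rintro ⟨x, y, z, h, e⟩
    by_cases hz : z = 0
    · subst hz
      have hx : x ≠ 0 := by simpa using h
      have e' : (d : K) * y ^ 2 = x ^ 4 := by rw [e, form]; ring
      have hy : y ≠ 0 := by
        rintro rfl
        exact pow_ne_zero 4 hx (by rw [← e']; ring)
      refine Or.inr ⟨x ^ 2 / y, ?_⟩
      field_simp
      rw [e']
    · refine Or.inl ⟨x / z, y / z ^ 2, ?_⟩
      unfold form at e
      field_simp
      linear_combination e
  · rintro (⟨x, y, e⟩ | ⟨r, hr⟩)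
    · exact ⟨x, y, 1, Or.inr one_ne_zero, by rw [e, form]; ring⟩
    · have h0 : r ≠ 0 := by
        rintro rfl
        exact hd (by simpa using hr)
      refine ⟨1, r⁻¹, 0, Or.inl one_ne_zero, ?_⟩
      rw [hr, form]
      field_simp
      ring

/-- `H^d` has points over every completion of `ℚ`, that is, over `ℝ` and over all `ℚ_p`. -/
def EverywhereLocallySolvable (d : ℤ) : Prop :=
  HasPoint d ℝ ∧ ∀ (p : ℕ) [Fact p.Prime], HasPoint d ℚ_[p]

end TwistedQuartic

/-! Let `N` be the norm form of `ℤ[ω]`, `ω² = 3 - ω`, the ring of integers of `ℚ(√13)`. The quartic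
form is `N(x + zω) · N((x + 2z) + 2zω)`. If `p` is inert in `ℚ(√13)`, the nonzero values of `N`
over `ℚ_p` have even valuation, so a point on `H^d` forces the valuation of `d` to be even; by
quadratic reciprocity, `p ≠ 13` is inert exactly when it is not a square modulo `13`.

Conversely, the form takes the values `1, 13, 27, -36` at `(1, 0), (-1, 1), (1, 1), (-2, 1)` and
vanishes at `(-1 + √13, 1)`, so `H^d` has a point over any field of characteristic `0` in which one
of `d`, `13d`, `3d`, `-d` or `13` is a square. For `p ∤ 26d` one of `13`, `d`, `13d` is a square in
`ℚ_p`, and for the other `p ∤ 26` it is `13`, by reciprocity. As `2` is not a square modulo `13`,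
`d` is odd, and one of `d`, `13d`, `3d`, `-d` is a square in `ℚ_2`. In `ℚ_13`, `-1` and every prime
`p ≠ 13` dividing `d` are squares, hence so is `d` or `13d`. -/

namespace TwistedQuartic

section Points

variable {K : Type*} [Field K] {d : ℤ}

theorem hasPoint_of_isSquare_mul {c : ℤ} {x z s : K} (hd : (d : K) ≠ 0) (hxz : x ≠ 0 ∨ z ≠ 0)
    (hform : form x z = c * s ^ 2) (hsq : IsSquare ((c * d : ℤ) : K)) : HasPoint d K := by
  obtain ⟨r, hr⟩ := hsq
  push_cast at hr
  refine ⟨x, r * s / d, z, hxz, ?_⟩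
  rw [hform]
  field_simp
  linear_combination -s ^ 2 * hr

theorem hasPoint_of_isSquare (hd : (d : K) ≠ 0) (h : IsSquare (d : K)) : HasPoint d K :=
  hasPoint_of_isSquare_mul (c := 1) (x := 1) (z := 0) (s := 1) hd (.inl one_ne_zero)
    (by simp [form]) (by simpa using h)

theorem hasPoint_of_isSquare_neg (hd : (d : K) ≠ 0) (h : IsSquare ((-d : ℤ) : K)) :
    HasPoint d K :=
  hasPoint_of_isSquare_mul (c := -1) (x := -2) (z := 1) (s := 6) hd (.inr one_ne_zero)
    (by simp only [form]; push_cast; ring) (by simpa using h)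

theorem hasPoint_of_isSquare_three_mul (hd : (d : K) ≠ 0) (h : IsSquare ((3 * d : ℤ) : K)) :
    HasPoint d K :=
  hasPoint_of_isSquare_mul (x := 1) (z := 1) (s := 3) hd (.inr one_ne_zero)
    (by simp only [form]; push_cast; ring) h

theorem hasPoint_of_isSquare_thirteen_mul (hd : (d : K) ≠ 0) (h : IsSquare ((13 * d : ℤ) : K)) :
    HasPoint d K :=
  hasPoint_of_isSquare_mul (x := -1) (z := 1) (s := 1) hd (.inr one_ne_zero)
    (by simp only [form]; push_cast; ring) h

theorem hasPoint_of_isSquare_thirteen (h : IsSquare ((13 : ℤ) : K)) : HasPoint d K := by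
  obtain ⟨r, hr⟩ := h
  push_cast at hr
  have hroot : form (-1 + r) 1 = 0 := by
    simp only [form]
    linear_combination -((-1 + r) ^ 2 - (-1 + r) - 3) * hr
  exact ⟨-1 + r, 0, 1, .inr one_ne_zero, by rw [hroot]; ring⟩

theorem hasPoint_real (hd : d ≠ 0) : HasPoint d ℝ := by
  have hd' : (d : ℝ) ≠ 0 := Int.cast_ne_zero.2 hd
  rcases le_total 0 d with hpos | hneg
  · exact hasPoint_of_isSquare hd' (Real.isSquare_iff.2 (Int.cast_nonneg hpos))
  · exact hasPoint_of_isSquare_neg hd'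
      (Real.isSquare_iff.2 (Int.cast_nonneg (neg_nonneg.2 hneg)))

end Points

section LegendreSymbol

theorem legendreSym_thirteen_two : legendreSym 13 2 = -1 :=
  (legendreSym.eq_neg_one_iff 13).2 (by decide)

theorem sq_ne_three_sub_zmod_two : ∀ r : ZMod 2, r ^ 2 ≠ 3 - r := by
  decide

variable {p : ℕ} [hp : Fact p.Prime]

theorem isSquare_of_legendreSym_eq_one {n : ℤ} (h : legendreSym p n = 1) :
    IsSquare (n : ZMod p) := by
  by_contra hns
  rw [(legendreSym.eq_neg_one_iff p).2 hns] at h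
  norm_num at h

theorem not_dvd_of_legendreSym_eq_one {n : ℤ} (h : legendreSym p n = 1) : ¬ (p : ℤ) ∣ n := by
  rw [← ZMod.intCast_zmod_eq_zero_iff_dvd, ← legendreSym.eq_zero_iff, h]
  exact one_ne_zero

theorem legendreSym_natCast_eq_one_of_forall_prime {n : ℕ}
    (h : ∀ q : ℕ, q.Prime → q ∣ n → legendreSym p q = 1) : legendreSym p n = 1 := by
  induction n using induction_on_primes with
  | zero => exact absurd dvd_rfl (not_dvd_of_legendreSym_eq_one (h p hp.out (dvd_zero p)))
  | one => simp
  | prime_mul q a hq ih =>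
    rw [Nat.cast_mul, legendreSym.mul, h q hq (dvd_mul_right q a),
      ih fun r hr hra => h r hr (hra.mul_left q), one_mul]

theorem legendreSym_eq_one_of_forall_prime (hp4 : p % 4 = 1) {n : ℤ}
    (h : ∀ q : ℕ, q.Prime → (q : ℤ) ∣ n → legendreSym p q = 1) : legendreSym p n = 1 := by
  have habs : legendreSym p n.natAbs = 1 :=
    legendreSym_natCast_eq_one_of_forall_prime fun q hq hqn => h q hq (Int.natCast_dvd.2 hqn)
  have hneg : legendreSym p (-1) = 1 := by
    rw [legendreSym.at_neg_one (by lia), ZMod.χ₄_nat_one_mod_four hp4]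
  rcases Int.natAbs_eq n with hn | hn
  · rwa [hn]
  · rw [hn, neg_eq_neg_one_mul, legendreSym.mul, hneg, habs, one_mul]

theorem legendreSym_thirteen_comm (hp2 : p ≠ 2) : legendreSym 13 p = legendreSym p 13 :=
  (legendreSym.quadratic_reciprocity_one_mod_four (p := 13) (by norm_num) hp2).symm

theorem intCast_thirteen_ne_zero (hp13 : p ≠ 13) : ((13 : ℤ) : ZMod p) ≠ 0 := by
  rw [Ne, ZMod.intCast_zmod_eq_zero_iff_dvd]
  exact_mod_cast mt (Nat.prime_dvd_prime_iff_eq hp.out (by norm_num)).1 hp13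

theorem sq_ne_three_sub_of_legendreSym_ne_one (hp13 : p ≠ 13) (h : legendreSym 13 p ≠ 1)
    (r : ZMod p) : r ^ 2 ≠ 3 - r := by
  rcases eq_or_ne p 2 with rfl | hp2
  · exact sq_ne_three_sub_zmod_two r
  intro hr
  rw [legendreSym_thirteen_comm hp2, Ne,
    legendreSym.eq_one_iff p (intCast_thirteen_ne_zero hp13)] at h
  exact h ⟨2 * r + 1, by push_cast; linear_combination -4 * hr⟩

end LegendreSymbol

section PadicSquares

variable {p : ℕ} [hp : Fact p.Prime]

theorem isSquare_of_norm_sq_sub_lt {n a : ℤ_[p]} (h : ‖a ^ 2 - n‖ < ‖2 * a‖ ^ 2) :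
    IsSquare n := by
  obtain ⟨z, hz, -⟩ := hensels_lemma (F := Polynomial.X ^ 2 - Polynomial.C n) (a := a)
    (by simpa [one_add_one_eq_two] using h)
  exact ⟨z, by simpa [sub_eq_zero, sq, eq_comm] using hz⟩

theorem isUnit_iff_toZMod_ne_zero {x : ℤ_[p]} : IsUnit x ↔ PadicInt.toZMod x ≠ 0 := by
  rw [Ne, ← RingHom.mem_ker, PadicInt.ker_toZMod, IsLocalRing.mem_maximalIdeal, mem_nonunits_iff,
    not_not]

theorem isSquare_of_isSquare_toZMod (hp2 : p ≠ 2) {n : ℤ_[p]} (hn : IsUnit n)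
    (h : IsSquare (PadicInt.toZMod n)) : IsSquare n := by
  obtain ⟨r, hr⟩ := h
  obtain ⟨a, rfl⟩ := ZMod.ringHom_surjective PadicInt.toZMod r
  have hdiff : ‖a ^ 2 - n‖ < 1 := by
    rw [← PadicInt.not_isUnit_iff, isUnit_iff_toZMod_ne_zero, not_not, map_sub, map_pow, hr]
    ring
  have hderiv : ‖2 * a‖ = 1 := by
    have : NeZero (2 : ZMod p) := ⟨Ring.two_ne_zero (by rwa [ZMod.ringChar_zmod_n])⟩
    rw [← PadicInt.isUnit_iff, isUnit_iff_toZMod_ne_zero, map_mul, map_ofNat]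
    refine mul_ne_zero two_ne_zero fun ha => ?_
    rw [isUnit_iff_toZMod_ne_zero, hr, ha, mul_zero] at hn
    exact hn rfl
  exact isSquare_of_norm_sq_sub_lt (by rwa [hderiv, one_pow])

theorem isSquare_padic_of_legendreSym_eq_one (hp2 : p ≠ 2) {n : ℤ} (h : legendreSym p n = 1) :
    IsSquare (n : ℚ_[p]) := by
  have hunit : IsUnit (n : ℤ_[p]) := by
    rw [isUnit_iff_toZMod_ne_zero, map_intCast, Ne, ZMod.intCast_zmod_eq_zero_iff_dvd]
    exact not_dvd_of_legendreSym_eq_one h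
  simpa using (isSquare_of_isSquare_toZMod hp2 hunit
    (by simpa using isSquare_of_legendreSym_eq_one h)).map (PadicInt.Coe.ringHom (p := p))

theorem isSquare_two_adic_of_emod_eight_eq_one {n : ℤ} (h : n % 8 = 1) :
    IsSquare (n : ℚ_[2]) := by
  have hdiff : ‖((1 - n : ℤ) : ℤ_[2])‖ ≤ 8⁻¹ := by
    have := (PadicInt.norm_int_le_pow_iff_dvd (p := 2) (k := 1 - n) (n := 3)).2 (by lia)
    norm_num at this ⊢
    exact this
  have hderiv : ‖(2 : ℤ_[2])‖ = 2⁻¹ := by simpa using PadicInt.norm_p (p := 2)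
  have hsq : IsSquare (n : ℤ_[2]) := by
    refine isSquare_of_norm_sq_sub_lt (a := 1) ?_
    rw [mul_one, one_pow, hderiv]
    push_cast at hdiff
    exact hdiff.trans_lt (by norm_num)
  simpa using hsq.map (PadicInt.Coe.ringHom (p := 2))

end PadicSquares

section Solvability

variable {d : ℤ}

theorem hasPoint_two_adic (h : ¬ (2 : ℤ) ∣ d) : HasPoint d ℚ_[2] := by
  have hd : (d : ℚ_[2]) ≠ 0 := Int.cast_ne_zero.2 (by rintro rfl; exact h (dvd_zero 2))
  have hmod : d % 8 = 1 ∨ d % 8 = 3 ∨ d % 8 = 5 ∨ d % 8 = 7 := by lia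
  rcases hmod with h1 | h3 | h5 | h7
  · exact hasPoint_of_isSquare hd (isSquare_two_adic_of_emod_eight_eq_one h1)
  · exact hasPoint_of_isSquare_three_mul hd (isSquare_two_adic_of_emod_eight_eq_one (by lia))
  · exact hasPoint_of_isSquare_thirteen_mul hd (isSquare_two_adic_of_emod_eight_eq_one (by lia))
  · exact hasPoint_of_isSquare_neg hd (isSquare_two_adic_of_emod_eight_eq_one (by lia))

theorem hasPoint_thirteen_adic (hd : Squarefree d)
    (h : ∀ p : ℕ, p.Prime → (p : ℤ) ∣ d → legendreSym 13 p = 1 ∨ p = 13) :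
    HasPoint d ℚ_[13] := by
  have hd0 : (d : ℚ_[13]) ≠ 0 := Int.cast_ne_zero.2 hd.ne_zero
  have hsq {m : ℤ} (hmd : m ∣ d) (hm : ¬ (13 : ℤ) ∣ m) : IsSquare (m : ℚ_[13]) :=
    isSquare_padic_of_legendreSym_eq_one (by norm_num) <|
      legendreSym_eq_one_of_forall_prime (by norm_num) fun p hp hpm =>
        (h p hp (hpm.trans hmd)).resolve_right (by rintro rfl; exact hm hpm)
  by_cases h13 : (13 : ℤ) ∣ d
  · obtain ⟨m, rfl⟩ := h13
    have hm : ¬ (13 : ℤ) ∣ m := fun hm =>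
      (Nat.prime_iff_prime_int.1 (by norm_num : Nat.Prime 13)).not_isUnit
        (hd 13 (mul_dvd_mul_left 13 hm))
    have hcast : ((13 * (13 * m) : ℤ) : ℚ_[13]) = 13 ^ 2 * m := by
      push_cast
      ring
    refine hasPoint_of_isSquare_thirteen_mul hd0 ?_
    rw [hcast]
    exact (IsSquare.sq 13).mul (hsq (dvd_mul_left m 13) hm)
  · exact hasPoint_of_isSquare hd0 (hsq dvd_rfl h13)

theorem hasPoint_padic_of_ne {p : ℕ} [hp : Fact p.Prime] (hp2 : p ≠ 2) (hp13 : p ≠ 13)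
    (hd : d ≠ 0) (h : (p : ℤ) ∣ d → legendreSym p 13 = 1) : HasPoint d ℚ_[p] := by
  have hd0 : (d : ℚ_[p]) ≠ 0 := Int.cast_ne_zero.2 hd
  by_cases h13 : legendreSym p 13 = 1
  · exact hasPoint_of_isSquare_thirteen (isSquare_padic_of_legendreSym_eq_one hp2 h13)
  have h13' : legendreSym p 13 = -1 :=
    (legendreSym.eq_one_or_neg_one p (intCast_thirteen_ne_zero hp13)).resolve_left h13
  have hpd : (d : ZMod p) ≠ 0 := mt (ZMod.intCast_zmod_eq_zero_iff_dvd d p).1 (mt h h13)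
  rcases legendreSym.eq_one_or_neg_one p hpd with hd1 | hd1
  · exact hasPoint_of_isSquare hd0 (isSquare_padic_of_legendreSym_eq_one hp2 hd1)
  · refine hasPoint_of_isSquare_thirteen_mul hd0 (isSquare_padic_of_legendreSym_eq_one hp2 ?_)
    rw [legendreSym.mul, h13', hd1, neg_one_mul, neg_neg]

end Solvability

section Obstruction

variable {p : ℕ} [hp : Fact p.Prime]

theorem exists_eq_mul_of_ne_zero {ι : Type*} [Finite ι] {v : ι → ℚ_[p]} (hv : v ≠ 0) :
    ∃ c : ℚ_[p], c ≠ 0 ∧ ∃ w : ι → ℤ_[p], (∀ i, v i = c * w i) ∧ ∃ i, IsUnit (w i) := by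
  obtain ⟨j, hj⟩ := Function.ne_iff.1 hv
  have : Nonempty ι := ⟨j⟩
  obtain ⟨i, hi⟩ := Finite.exists_max (‖v ·‖)
  have hvi : v i ≠ 0 := norm_pos_iff.1 ((norm_pos_iff.2 hj).trans_le (hi j))
  have hle (k : ι) : ‖v k / v i‖ ≤ 1 := by
    rw [norm_div]
    exact div_le_one_of_le₀ (hi k) (norm_nonneg _)
  exact ⟨v i, hvi, fun k => ⟨v k / v i, hle k⟩, fun k => (mul_div_cancel₀ (v k) hvi).symm, i,
    PadicInt.isUnit_iff.2 (by simp [hvi])⟩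

theorem isUnit_norm_of_isUnit_re_or_im {a b : ℤ_[p]}
    (hirr : ∀ r : ZMod p, r ^ 2 ≠ PadicInt.toZMod a + PadicInt.toZMod b * r)
    {z : QuadraticAlgebra ℤ_[p] a b} (hz : IsUnit z.re ∨ IsUnit z.im) : IsUnit z.norm := by
  have : Fact (∀ r : ZMod p, r ^ 2 ≠ PadicInt.toZMod a + PadicInt.toZMod b * r) := ⟨hirr⟩
  let zbar : QuadraticAlgebra (ZMod p) (PadicInt.toZMod a) (PadicInt.toZMod b) :=
    ⟨PadicInt.toZMod z.re, PadicInt.toZMod z.im⟩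
  have hnorm : PadicInt.toZMod z.norm = zbar.norm := by
    simp only [zbar, QuadraticAlgebra.norm_def, map_sub, map_add, map_mul]
  rw [isUnit_iff_toZMod_ne_zero, hnorm, Ne, QuadraticAlgebra.norm_eq_zero_iff_eq_zero,
    QuadraticAlgebra.ext_iff, not_and_or]
  simp only [isUnit_iff_toZMod_ne_zero] at hz
  exact hz

theorem valuation_eq_zero_of_isUnit {x : ℤ_[p]} (hx : IsUnit x) : x.valuation = 0 := by
  obtain ⟨u, rfl⟩ := hx
  have hmul := PadicInt.valuation_mul u.ne_zero u⁻¹.ne_zero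
  rw [Units.mul_inv, PadicInt.valuation_one] at hmul
  lia

theorem norm_ne_zero_and_even_valuation {a b : ℤ_[p]}
    (hirr : ∀ r : ZMod p, r ^ 2 ≠ PadicInt.toZMod a + PadicInt.toZMod b * r)
    {z : QuadraticAlgebra ℚ_[p] a b} (hz : z ≠ 0) : z.norm ≠ 0 ∧ Even z.norm.valuation := by
  have hv : ![z.re, z.im] ≠ 0 := by
    contrapose! hz
    exact QuadraticAlgebra.ext (congrFun hz 0) (congrFun hz 1)
  obtain ⟨c, hc, w, hw, i, hi⟩ := exists_eq_mul_of_ne_zero hv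
  let z₀ : QuadraticAlgebra ℤ_[p] a b := ⟨w 0, w 1⟩
  have hz₀ : IsUnit z₀.norm := by
    refine isUnit_norm_of_isUnit_re_or_im hirr ?_
    fin_cases i
    · exact .inl hi
    · exact .inr hi
  have hnorm : z.norm = c ^ 2 * (z₀.norm : ℤ_[p]) := by
    have hre : z.re = c * w 0 := hw 0
    have him : z.im = c * w 1 := hw 1
    rw [QuadraticAlgebra.norm_def, QuadraticAlgebra.norm_def, hre, him]
    push_cast
    ring
  have hne : ((z₀.norm : ℤ_[p]) : ℚ_[p]) ≠ 0 := PadicInt.coe_ne_zero.2 hz₀.ne_zero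
  rw [hnorm]
  refine ⟨mul_ne_zero (pow_ne_zero 2 hc) hne, ?_⟩
  rw [Padic.valuation_mul (pow_ne_zero 2 hc) hne, Padic.valuation_pow, PadicInt.valuation_coe,
    valuation_eq_zero_of_isUnit hz₀, Nat.cast_zero, add_zero]
  exact even_two.mul_right _

theorem form_eq_norm_mul_norm {K : Type*} [Field K] (x z : K) :
    form x z = (⟨x, z⟩ : QuadraticAlgebra K 3 (-1)).norm *
      (⟨x + 2 * z, 2 * z⟩ : QuadraticAlgebra K 3 (-1)).norm := by
  simp only [form, QuadraticAlgebra.norm_def]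
  ring

theorem form_ne_zero_and_even_valuation (hirr : ∀ r : ZMod p, r ^ 2 ≠ 3 - r) {x z : ℚ_[p]}
    (hxz : x ≠ 0 ∨ z ≠ 0) : form x z ≠ 0 ∧ Even (form x z).valuation := by
  have hirr' (r : ZMod p) :
      r ^ 2 ≠ PadicInt.toZMod (3 : ℤ_[p]) + PadicInt.toZMod (-1 : ℤ_[p]) * r := by
    rw [map_ofNat, map_neg, map_one, neg_one_mul, ← sub_eq_add_neg]
    exact hirr r
  let z₁ : QuadraticAlgebra ℚ_[p] (3 : ℤ_[p]) (-1 : ℤ_[p]) := ⟨x, z⟩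
  let z₂ : QuadraticAlgebra ℚ_[p] (3 : ℤ_[p]) (-1 : ℤ_[p]) := ⟨x + 2 * z, 2 * z⟩
  have hz₁ : z₁ ≠ 0 := by
    rw [Ne, QuadraticAlgebra.ext_iff, not_and_or]
    exact hxz
  have hz₂ : z₂ ≠ 0 := by
    intro h
    have hz : z = 0 := by simpa [z₂] using congrArg QuadraticAlgebra.im h
    have hx : x = 0 := by simpa [z₂, hz] using congrArg QuadraticAlgebra.re h
    exact hxz.elim (· hx) (· hz)
  obtain ⟨hne₁, heven₁⟩ := norm_ne_zero_and_even_valuation hirr' hz₁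
  obtain ⟨hne₂, heven₂⟩ := norm_ne_zero_and_even_valuation hirr' hz₂
  have hform : form x z = z₁.norm * z₂.norm := form_eq_norm_mul_norm x z
  rw [hform, Padic.valuation_mul hne₁ hne₂]
  exact ⟨mul_ne_zero hne₁ hne₂, heven₁.add heven₂⟩

theorem not_hasPoint_of_odd_padicValInt (hirr : ∀ r : ZMod p, r ^ 2 ≠ 3 - r) {d : ℤ}
    (hodd : Odd (padicValInt p d)) : ¬ HasPoint d ℚ_[p] := by
  rintro ⟨x, y, z, hxz, hxyz⟩
  obtain ⟨hne, heven⟩ := form_ne_zero_and_even_valuation hirr hxz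
  rw [← hxyz] at hne heven
  obtain ⟨hd, hy⟩ := mul_ne_zero_iff.1 hne
  rw [Padic.valuation_mul hd hy, Padic.valuation_pow, Padic.valuation_intCast,
    Int.even_add] at heven
  have := heven.2 (even_two.mul_right _)
  exact Nat.not_even_iff_odd.2 hodd (by exact_mod_cast this)

theorem padicValInt_eq_one_of_squarefree {d : ℤ} (hd : Squarefree d) (hpd : (p : ℤ) ∣ d) :
    padicValInt p d = 1 := by
  obtain ⟨m, rfl⟩ := hpd
  have hm : ¬ (p : ℤ) ∣ m := fun hm =>
    (Nat.prime_iff_prime_int.1 hp.out).not_isUnit (hd p (mul_dvd_mul_left _ hm))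
  rw [padicValInt.mul (left_ne_zero_of_mul hd.ne_zero) (right_ne_zero_of_mul hd.ne_zero),
    padicValInt.self hp.out.one_lt, padicValInt.eq_zero_of_not_dvd hm]

end Obstruction

end TwistedQuartic

open TwistedQuartic

theorem proposition2p1 (d : ℤ) (hd : Squarefree d) :
    TwistedQuartic.EverywhereLocallySolvable d ↔
      ∀ p : ℕ, p.Prime → (p : ℤ) ∣ d → legendreSym 13 (p : ℤ) = 1 ∨ p = 13 := by
  constructor
  · rintro ⟨-, hloc⟩ p hp hpd
    have : Fact p.Prime := ⟨hp⟩
    by_contra! hc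
    have hodd : Odd (padicValInt p d) := by simp [padicValInt_eq_one_of_squarefree hd hpd]
    exact not_hasPoint_of_odd_padicValInt (sq_ne_three_sub_of_legendreSym_ne_one hc.2 hc.1) hodd
      (hloc p)
  · refine fun h => ⟨hasPoint_real hd.ne_zero, fun p hp => ?_⟩
    rcases eq_or_ne p 13 with rfl | hp13
    · exact hasPoint_thirteen_adic hd h
    have hleg (hpd : (p : ℤ) ∣ d) : legendreSym 13 p = 1 := (h p hp.out hpd).resolve_right hp13
    rcases eq_or_ne p 2 with rfl | hp2
    · refine hasPoint_two_adic fun h2 => ?_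
      have := (hleg h2).symm.trans legendreSym_thirteen_two
      norm_num at this
    · exact hasPoint_padic_of_ne hp2 hp13 hd.ne_zero
        fun hpd => (legendreSym_thirteen_comm hp2).symm.trans (hleg hpd)
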